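/- Let $d\ge 2$ and $\alpha\in[1,d]$, and write $k=\lfloor\alpha\rfloor$, $\theta=\alpha-k\in[0,1)$, $r=\lceil\alpha\rceil$. For $\psi\in\mathbb C^d\otimes\mathbb C^d$ let $s_1(\psi)\ge\dots\ge s_d(\psi)\ge 0$ be its Schmidt coefficients, extended by $s_j(\psi)=0$ for $j>d$. Let $\mathcal V_\alpha$ be the set of unit vectors $\psi$ with $s_j(\psi)=0$ for all $j\ge r+1$ and, if $\theta>0$, $s_{k+1}(\psi)\le\frac{\theta}{k}\sum_{j=1}^k s_j(\psi)$. Let $\mathsf K_\alpha$ be the closure of the set of all finite sums $\sum_i t_i\psi_i\psi_i^*$ with $t_i\ge 0$ and $\psi_i\in\mathcal V_\alpha$. Put $\omega=d^{-1/2}\sum_{i=1}^d e_i\otimes e_i$, $P_\omega=\omega\omega^*$, $f_d(\alpha)=\sup_{\psi\in\mathcal V_\alpha}\langle\psi,P_\omega\psi\rangle$, and, for $0\le F\le 1$, \[ \rho_F=\frac{1-F}{d^2-1}(I-P_\omega)+F\,P_\omega . \] Then: (a) The supremum defining $f_d(\alpha)$ is a maximum, and \[ f_d(\alpha)=\max_{\psi\in\mathcal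 V_\alpha}\langle\psi,P_\omega\psi\rangle=\frac{(k+\theta)^2}{d\,(k+\theta^2)} . \] It is attained by some $\psi\in\mathcal V_\alpha$ with $s_1(\psi)=\dots=s_k(\psi)=\frac{1}{\sqrt{k+\theta^2}}$, $s_{k+1}(\psi)=\frac{\theta}{\sqrt{k+\theta^2}}$ and $s_j(\psi)=0$ for $j\ge k+2$. (b) For every $F\in[0,1]$, $\rho_F\in\mathsf K_\alpha$ if and only if $F\le f_d(\alpha)$. (c) In particular, for every integer $k\in\{1,\dots,d\}$ one has $f_d(k)=k/d$, and for every $F\in[0,1]$, $\rho_F\in\mathsf K_k$ if and only if $F\le k/d$. -/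

import Mathlib

namespace FractionalPositivity

open scoped BigOperators

noncomputable section

/-- The Hilbert space `ℂⁿ ⊗ ℂᵐ`, in coordinates: the `(i, j)` coordinate of a vector is its
coefficient at `e_i ⊗ f_j`. -/
abbrev BipartiteVec (n m : ℕ) : Type := EuclideanSpace ℂ (Fin n × Fin m)

/-- The algebra `M_n ⊗ M_m` of operators on `ℂⁿ ⊗ ℂᵐ`. -/
abbrev BipartiteOp (n m : ℕ) : Type := Matrix (Fin n × Fin m) (Fin n × Fin m) ℂ

/-- The matricization `mat(ψ) = [a_{ij}]` of `ψ = ∑ a_{ij} e_i ⊗ f_j`. -/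
def matricize {n m : ℕ} (ψ : BipartiteVec n m) : Matrix (Fin n) (Fin m) ℂ :=
  Matrix.of fun i j => ψ (i, j)

/-- The ordered Schmidt coefficients of `ψ`, i.e. the singular values of its matricization in
decreasing order and extended by zeros. They are indexed from `0`: `schmidtCoeff ψ j` is the
coefficient usually written `s_{j+1}(ψ)`. -/
def schmidtCoeff {n m : ℕ} (ψ : BipartiteVec n m) (j : ℕ) : ℝ :=
  (Matrix.toEuclideanLin (matricize ψ)).singularValues j

/-- The set `V_α` of `α`-admissible unit vectors of `ℂⁿ ⊗ ℂᵐ`. With `k = ⌊α⌋`, `θ = α - k` and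
`r = ⌈α⌉`: all Schmidt coefficients after the first `r` vanish and, if `θ > 0`, then
`s_{k+1} ≤ (θ / k) (s_1 + ⋯ + s_k)`. -/
def admissible (n m : ℕ) (α : ℝ) : Set (BipartiteVec n m) :=
  {ψ | ‖ψ‖ = 1 ∧
    (∀ j : ℕ, ⌈α⌉₊ ≤ j → schmidtCoeff ψ j = 0) ∧
    (0 < α - ⌊α⌋₊ →
      schmidtCoeff ψ ⌊α⌋₊ ≤
        (α - ⌊α⌋₊) / ⌊α⌋₊ * ∑ j ∈ Finset.range ⌊α⌋₊, schmidtCoeff ψ j)}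

/-- The rank-one operator `ψ ψ*`. -/
def ketBra {n m : ℕ} (ψ : BipartiteVec n m) : BipartiteOp n m :=
  Matrix.of fun p q => ψ p * star (ψ q)

/-- The fractional `α`-superpositive cone `K_α`: the closure of the set of finite combinations,
with nonnegative real coefficients, of the operators `ψ ψ*` with `ψ ∈ V_α`. -/
def superpositiveCone (n m : ℕ) (α : ℝ) : Set (BipartiteOp n m) :=
  closure (PointedCone.hull ℝ (ketBra '' admissible n m α) : Set (BipartiteOp n m))

/-- The quadratic form `⟨ψ, W ψ⟩`, which is real when `W` is Hermitian. -/
def quadForm {n m : ℕ} (W : BipartiteOp n m) (ψ : BipartiteVec n m) : ℝ :=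
  (inner ℂ ψ (Matrix.toEuclideanLin W ψ)).re

/-- `μ_α(W)`, the largest value of `⟨ψ, W ψ⟩` over `ψ ∈ V_α`. -/
def muAlpha {n m : ℕ} (α : ℝ) (W : BipartiteOp n m) : ℝ :=
  sSup (quadForm W '' admissible n m α)

/-- The maximally entangled unit vector `ω = d^{-1/2} ∑ e_i ⊗ e_i`. -/
def omegaVec (d : ℕ) : BipartiteVec d d :=
  ((1 / Real.sqrt d : ℝ) : ℂ) • ∑ i : Fin d, EuclideanSpace.single (i, i) (1 : ℂ)

/-- The rank-one projection `P_ω = ω ω*`. -/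
def omegaProj (d : ℕ) : BipartiteOp d d := ketBra (omegaVec d)

/-- The isotropic state `ρ_F = (1 - F) / (d² - 1) (I - P_ω) + F P_ω`. -/
def isotropicState (d : ℕ) (F : ℝ) : BipartiteOp d d :=
  ((1 - F) / ((d : ℝ) ^ 2 - 1)) • (1 - omegaProj d) + F • omegaProj d

/-- The profile `f_d(α) = μ_α(P_ω)`. -/
def profile (d : ℕ) (α : ℝ) : ℝ := muAlpha α (omegaProj d)

end

end FractionalPositivity

/-!
For `ψ` with matricization `A` one has `⟨ψ, P_ω ψ⟩ = |tr A|² / d`. Since `|tr A|` is at most the sum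
of the singular values of `A` (`norm_trace_matricize_le`) and their squares sum to `‖ψ‖² = 1`, the
value of the profile is an extremal problem for the Schmidt coefficients. If `S` denotes the sum of
the first `k` of them, Cauchy-Schwarz and the constraint `s_{k+1} ≤ θ S / k` give the upper bound
(`sq_add_le_of_le_mul_div`), and the diagonal vector with coefficients proportional to
`1, …, 1, θ, 0, …, 0` attains it (`exists_mem_admissible_maximizer`).

If `ρ_F` lies in the cone, then `F = tr (P_ω ρ_F) ≤ f_d(α) tr ρ_F = f_d(α)`, because this linear
inequality holds on the generators (`le_of_isotropicState_mem_superpositiveCone`). Conversely, the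
Schmidt coefficients and the overlap with `ω` are invariant under `U ⊗ Ū`, so the slice
`{X ∈ K_α | tr X = 1, tr (P_ω X) = F}` is a closed convex set stable under conjugation by all
`U ⊗ Ū`. Instead of averaging over the unitary group with Haar measure, take the point of minimal
Hilbert-Schmidt norm of a nonempty slice: it is unique, hence invariant
(`exists_mem_unitary_conj_fixed`). The invariant operators are the combinations of `1` and `P_ω`
(`IsTwirlInvariant.exists_eq_smul_one_add_smul_omegaProj`), so this point is `ρ_F`. Hence `ρ_F` is
in the cone as soon as `F` is the overlap of an admissible vector. The maximizer gives
`F = f_d(α)`, the product vector `e₁ ⊗ e₂` gives `F = 0`, and convexity gives the values between.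
-/

namespace FractionalPositivity

open Matrix Kronecker

/-! ### Schmidt coefficients -/

theorem charpoly_adjoint_comp_toEuclideanLin {m n : ℕ} (A : Matrix (Fin m) (Fin n) ℂ) :
    (LinearMap.adjoint (toEuclideanLin A) ∘ₗ toEuclideanLin A).charpoly =
      (Aᴴ * A).charpoly := by
  rw [← toEuclideanLin_conjTranspose_eq_adjoint]
  have : toEuclideanLin Aᴴ ∘ₗ toEuclideanLin A = toEuclideanLin (Aᴴ * A) := by
    ext x i
    simp [toLpLin_apply, mulVec_mulVec]
  rw [this, ← LinearMap.charpoly_toMatrix _ (EuclideanSpace.basisFun (Fin n) ℂ).toBasis]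
  congr 1
  ext i j
  simp [LinearMap.toMatrix_apply, toLpLin_apply, mul_apply, mulVec, dotProduct]

theorem schmidtCoeff_of_le {n m : ℕ} (ψ : BipartiteVec n m) {j : ℕ} (hj : m ≤ j) :
    schmidtCoeff ψ j = 0 :=
  LinearMap.singularValues_of_finrank_le _ (by simpa using hj)

theorem schmidtCoeff_nonneg {n m : ℕ} (ψ : BipartiteVec n m) (j : ℕ) : 0 ≤ schmidtCoeff ψ j :=
  LinearMap.singularValues_nonneg _ _

/-- Schmidt coefficients are determined by the characteristic polynomial of `mat(ψ)ᴴ mat(ψ)`. -/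
theorem schmidtCoeff_congr {n m : ℕ} {ψ φ : BipartiteVec n m}
    (h : ((matricize ψ)ᴴ * matricize ψ).charpoly = ((matricize φ)ᴴ * matricize φ).charpoly) :
    schmidtCoeff ψ = schmidtCoeff φ := by
  rw [← charpoly_adjoint_comp_toEuclideanLin, ← charpoly_adjoint_comp_toEuclideanLin] at h
  funext j
  rcases le_or_gt m j with hj | hj
  · rw [schmidtCoeff_of_le _ hj, schmidtCoeff_of_le _ hj]
  · have hn : Module.finrank ℂ (EuclideanSpace ℂ (Fin m)) = m := by simp
    unfold schmidtCoeff
    rw [LinearMap.singularValues_of_lt _ hn hj, LinearMap.singularValues_of_lt _ hn hj,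
      (LinearMap.IsSymmetric.eigenvalues_eq_eigenvalues_iff _ hn _ hn).2 h]

/-- An antitone nonnegative diagonal matrix has its own diagonal as Schmidt coefficients. -/
theorem schmidtCoeff_of_matricize_eq_diagonal {d : ℕ} {ψ : BipartiteVec d d} {g : ℕ → ℝ}
    (hg : Antitone g) (hg0 : ∀ j, 0 ≤ g j)
    (h : matricize ψ = diagonal fun i : Fin d => (g i : ℂ)) {j : ℕ} (hj : j < d) :
    schmidtCoeff ψ j = g j := by
  have hn : Module.finrank ℂ (EuclideanSpace ℂ (Fin d)) = d := by simp
  set T := toEuclideanLin (matricize ψ) with hT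
  have hsq : Antitone fun i : Fin d => g i ^ 2 := fun a b hab =>
    pow_le_pow_left₀ (hg0 _) (hg hab) 2
  have hcp : (LinearMap.adjoint T ∘ₗ T).charpoly.roots =
      Multiset.map (fun i : Fin d => ((g i ^ 2 : ℝ) : ℂ)) Finset.univ.val := by
    have hgram : (matricize ψ)ᴴ * matricize ψ =
        diagonal fun i : Fin d => ((g i ^ 2 : ℝ) : ℂ) := by
      rw [h, diagonal_conjTranspose, diagonal_mul_diagonal]
      simp [pow_two]
    rw [hT, charpoly_adjoint_comp_toEuclideanLin, hgram,
      charpoly_diagonal, Polynomial.roots_prod _ _ (by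
        simp only [ne_eq, Finset.prod_ne_zero_iff, Polynomial.X_sub_C_ne_zero]; simp)]
    simp only [Polynomial.roots_X_sub_C, Multiset.bind_singleton]
  have key := LinearMap.IsSymmetric.sort_roots_charpoly_eq_eigenvalues
    T.isSymmetric_adjoint_comp_self hn
  have : (Multiset.map (RCLike.re : ℂ → ℝ) (LinearMap.adjoint T ∘ₗ T).charpoly.roots).sort
      (· ≥ ·) = List.ofFn fun i : Fin d => g i ^ 2 := by
    rw [hcp]
    simp_rw [Fin.univ_val_map, Multiset.map_coe, List.map_ofFn, Function.comp_def,
      RCLike.re_eq_complex_re, Complex.ofReal_re, Multiset.coe_sort]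
    apply List.mergeSort_of_pairwise
    simp_rw [decide_eq_true_eq, ← List.sortedGE_iff_pairwise]
    exact hsq.sortedGE_ofFn
  rw [this, List.ofFn_inj] at key
  unfold schmidtCoeff
  rw [LinearMap.singularValues_of_lt _ hn hj, ← congrFun key ⟨j, hj⟩]
  exact Real.sqrt_sq (hg0 _)

theorem norm_sq_eq_sum_schmidtCoeff_sq {d : ℕ} (ψ : BipartiteVec d d) :
    ‖ψ‖ ^ 2 = ∑ j ∈ Finset.range d, schmidtCoeff ψ j ^ 2 := by
  have hn : Module.finrank ℂ (EuclideanSpace ℂ (Fin d)) = d := by simp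
  set A := matricize ψ with hA
  set T := toEuclideanLin A with hT
  have h1 : (∑ i : Fin d, schmidtCoeff ψ i ^ 2 : ℝ) = (Aᴴ * A).trace.re := by
    have hs := (LinearMap.isSymmetric_adjoint_comp_self T).charpoly_eq hn
    rw [charpoly_adjoint_comp_toEuclideanLin] at hs
    have hroots := trace_eq_sum_roots_charpoly (Aᴴ * A)
    rw [hs, Polynomial.roots_prod _ _ (by
        simp [Finset.prod_ne_zero_iff, Polynomial.X_sub_C_ne_zero])] at hroots
    rw [hroots]
    simp only [Polynomial.roots_X_sub_C, Multiset.bind_singleton, Finset.sum_map_val,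
      Complex.re_sum]
    refine Finset.sum_congr rfl fun i _ => ?_
    exact LinearMap.sq_singularValues_fin T hn i
  rw [Finset.sum_range, h1, EuclideanSpace.norm_sq_eq, Fintype.sum_prod_type, Finset.sum_comm]
  simp only [trace, diag, mul_apply, conjTranspose_apply, Complex.re_sum]
  refine Finset.sum_congr rfl fun i _ => Finset.sum_congr rfl fun j _ => ?_
  simp [hA, matricize, ← Complex.normSq_eq_norm_sq, Complex.normSq_apply]

/-- The trace is dominated by the trace norm: in an orthonormal basis `v` of right singular
vectors, `tr A = ∑ ⟪v j, A v j⟫` and `‖A v j‖ = s j`. -/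
theorem norm_trace_matricize_le {d : ℕ} (ψ : BipartiteVec d d) :
    ‖(matricize ψ).trace‖ ≤ ∑ j ∈ Finset.range d, schmidtCoeff ψ j := by
  have hn : Module.finrank ℂ (EuclideanSpace ℂ (Fin d)) = d := by simp
  set A := matricize ψ with hA
  set T := toEuclideanLin A with hT
  set b := T.isSymmetric_adjoint_comp_self.eigenvectorBasis hn with hb
  have htr : A.trace = ∑ i, inner ℂ (b i) (T (b i)) := by
    rw [← LinearMap.trace_eq_sum_inner T b,
      LinearMap.trace_eq_matrix_trace ℂ (EuclideanSpace.basisFun (Fin d) ℂ).toBasis]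
    congr 1
    ext i j
    simp [LinearMap.toMatrix_apply, hT, toLpLin_apply]
  rw [htr, Finset.sum_range]
  refine (norm_sum_le _ _).trans (Finset.sum_le_sum fun i _ => ?_)
  refine (norm_inner_le_norm _ _).trans ?_
  rw [b.norm_eq_one, one_mul]
  refine le_of_eq ?_
  rw [← sq_eq_sq₀ (norm_nonneg _) (schmidtCoeff_nonneg _ _)]
  have h1 : (‖T (b i)‖ : ℂ) ^ 2 =
      ((T.isSymmetric_adjoint_comp_self.eigenvalues hn i : ℝ) : ℂ) := by
    have := inner_self_eq_norm_sq_to_K (𝕜 := ℂ) (T (b i))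
    rw [← LinearMap.adjoint_inner_right, ← LinearMap.comp_apply, hb,
      LinearMap.IsSymmetric.apply_eigenvectorBasis, inner_smul_right, ← hb,
      inner_self_eq_norm_sq_to_K, b.norm_eq_one] at this
    simpa using this.symm
  rw [show schmidtCoeff ψ i = T.singularValues i from rfl, LinearMap.sq_singularValues_fin T hn i]
  exact_mod_cast h1

/-! ### The action of the unitary group -/

theorem ketBra_eq_vecMulVec {n m : ℕ} (ψ : BipartiteVec n m) :
    ketBra ψ = vecMulVec ψ (star (ψ : Fin n × Fin m → ℂ)) := by
  ext p q
  simp [ketBra, vecMulVec_apply]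

theorem trace_ketBra {n m : ℕ} (ψ : BipartiteVec n m) : (ketBra ψ).trace = (‖ψ‖ ^ 2 : ℝ) := by
  rw [EuclideanSpace.norm_sq_eq]
  simp [ketBra, trace, diag, Complex.mul_conj, Complex.normSq_eq_norm_sq]

theorem trace_mul_ketBra {n m : ℕ} (W : BipartiteOp n m) (ψ : BipartiteVec n m) :
    (W * ketBra ψ).trace = inner ℂ ψ (toEuclideanLin W ψ) := by
  rw [ketBra_eq_vecMulVec, mul_vecMulVec, trace_vecMulVec, EuclideanSpace.inner_eq_star_dotProduct]
  rfl

/-- The operator `U ⊗ Ū` on `ℂᵈ ⊗ ℂᵈ`. On matricizations it acts by `A ↦ U A Uᴴ`, see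
`matricize_twirl`. -/
def twirl {d : ℕ} (U : Matrix (Fin d) (Fin d) ℂ) : BipartiteOp d d := U ⊗ₖ U.map star

theorem twirl_apply {d : ℕ} (U : Matrix (Fin d) (Fin d) ℂ) (p q : Fin d × Fin d) :
    twirl U p q = U p.1 q.1 * star (U p.2 q.2) := rfl

theorem matricize_twirl {d : ℕ} (U : Matrix (Fin d) (Fin d) ℂ) (ψ : BipartiteVec d d) :
    matricize (toEuclideanLin (twirl U) ψ) = U * matricize ψ * Uᴴ := by
  ext i j
  simp only [matricize, of_apply, toLpLin_apply, mulVec, dotProduct, twirl_apply, mul_apply,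
    Fintype.sum_prod_type, conjTranspose_apply, Finset.sum_mul]
  rw [Finset.sum_comm]
  exact Finset.sum_congr rfl fun _ _ => Finset.sum_congr rfl fun _ _ => by ring

theorem twirl_mem_unitaryGroup {d : ℕ} {U : Matrix (Fin d) (Fin d) ℂ}
    (hU : U ∈ unitaryGroup (Fin d) ℂ) : twirl U ∈ unitaryGroup (Fin d × Fin d) ℂ := by
  refine kronecker_mem_unitary hU ?_
  rw [mem_unitaryGroup_iff] at hU ⊢
  have : U.map star * star (U.map star) = (U * star U).map star := by
    ext i j
    simp [mul_apply, star_apply]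
  rw [this, hU]
  ext i j
  simp [one_apply, apply_ite]

theorem schmidtCoeff_twirl {d : ℕ} {U : Matrix (Fin d) (Fin d) ℂ}
    (hU : U ∈ unitaryGroup (Fin d) ℂ) (ψ : BipartiteVec d d) :
    schmidtCoeff (toEuclideanLin (twirl U) ψ) = schmidtCoeff ψ := by
  apply schmidtCoeff_congr
  have hU' : Uᴴ * U = 1 := mem_unitaryGroup_iff'.1 hU
  have : (U * matricize ψ * Uᴴ)ᴴ * (U * matricize ψ * Uᴴ) =
      U * ((matricize ψ)ᴴ * matricize ψ * Uᴴ) := by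
    rw [conjTranspose_mul, conjTranspose_mul, conjTranspose_conjTranspose]
    calc _ = U * ((matricize ψ)ᴴ * ((Uᴴ * U) * (matricize ψ * Uᴴ))) := by
          simp only [Matrix.mul_assoc]
      _ = _ := by rw [hU', Matrix.one_mul, Matrix.mul_assoc]
  rw [matricize_twirl, this, charpoly_mul_comm, Matrix.mul_assoc, hU', Matrix.mul_one]

/-- Admissibility only depends on the Schmidt coefficients, as these determine the norm. -/
theorem mem_admissible_of_schmidtCoeff_eq {d : ℕ} {α : ℝ} {ψ φ : BipartiteVec d d}
    (h : schmidtCoeff φ = schmidtCoeff ψ) (hψ : ψ ∈ admissible d d α) :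
    φ ∈ admissible d d α := by
  obtain ⟨h1, h2, h3⟩ := hψ
  refine ⟨?_, by rwa [h], by rwa [h]⟩
  rw [← h1, ← sq_eq_sq₀ (norm_nonneg _) (norm_nonneg _), norm_sq_eq_sum_schmidtCoeff_sq,
    norm_sq_eq_sum_schmidtCoeff_sq, h]

theorem ketBra_toEuclideanLin {n m : ℕ} (W : BipartiteOp n m) (ψ : BipartiteVec n m) :
    ketBra (toEuclideanLin W ψ) = W * ketBra ψ * Wᴴ := by
  rw [ketBra_eq_vecMulVec, ketBra_eq_vecMulVec, mul_vecMulVec, vecMulVec_mul, ← star_mulVec]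
  rfl

theorem convex_superpositiveCone {n m : ℕ} (α : ℝ) : Convex ℝ (superpositiveCone n m α) :=
  (PointedCone.hull ℝ (ketBra '' admissible n m α)).convex.closure

theorem ketBra_mem_superpositiveCone {n m : ℕ} {α : ℝ} {ψ : BipartiteVec n m}
    (hψ : ψ ∈ admissible n m α) : ketBra ψ ∈ superpositiveCone n m α :=
  subset_closure (Submodule.subset_span ⟨ψ, hψ, rfl⟩)

theorem twirl_conj_mem_superpositiveCone {d : ℕ} {α : ℝ} {U : Matrix (Fin d) (Fin d) ℂ}
    (hU : U ∈ unitaryGroup (Fin d) ℂ) {X : BipartiteOp d d}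
    (hX : X ∈ superpositiveCone d d α) :
    twirl U * X * (twirl U)ᴴ ∈ superpositiveCone d d α := by
  have hcont : Continuous fun X : BipartiteOp d d => twirl U * X * (twirl U)ᴴ := by fun_prop
  refine map_mem_closure (f := fun X => twirl U * X * (twirl U)ᴴ) hcont hX fun Y hY => ?_
  refine Submodule.span_induction (p := fun Y _ => twirl U * Y * (twirl U)ᴴ ∈
    PointedCone.hull ℝ (ketBra '' admissible d d α)) ?_ ?_ ?_ ?_ hY
  · rintro _ ⟨ψ, hψ, rfl⟩
    exact Submodule.subset_span ⟨_, mem_admissible_of_schmidtCoeff_eq (schmidtCoeff_twirl hU ψ) hψ,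
      ketBra_toEuclideanLin _ _⟩
  · simp
  · intro x y _ _ hx hy
    rw [Matrix.mul_add, Matrix.add_mul]
    exact add_mem hx hy
  · intro a x _ hx
    rw [Matrix.mul_smul, Matrix.smul_mul]
    exact Submodule.smul_mem _ a hx

/-! ### The maximally entangled state -/

theorem omegaVec_apply {d : ℕ} (i j : Fin d) :
    omegaVec d (i, j) = if i = j then ((1 / Real.sqrt d : ℝ) : ℂ) else 0 := by
  simp only [omegaVec, PiLp.smul_apply, WithLp.ofLp_sum, Finset.sum_apply, PiLp.single_apply,
    Prod.mk.injEq, smul_eq_mul]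
  split_ifs with h
  · subst h
    simp
  · rw [Finset.sum_eq_zero, mul_zero]
    intro x _
    rw [if_neg]
    rintro ⟨rfl, rfl⟩
    exact h rfl

theorem omegaProj_apply {d : ℕ} (i j k l : Fin d) :
    omegaProj d (i, j) (k, l) = if i = j ∧ k = l then (1 / d : ℂ) else 0 := by
  have : (((1 / Real.sqrt d : ℝ) : ℂ)) * ((1 / Real.sqrt d : ℝ) : ℂ) = 1 / d := by
    rw [← Complex.ofReal_mul, div_mul_div_comm, Real.mul_self_sqrt (by positivity)]
    simp
  simp only [omegaProj, ketBra, of_apply, omegaVec_apply]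
  by_cases h : i = j <;> by_cases h' : k = l <;> simp [h, h']
  simpa using this

theorem trace_omegaProj_mul {d : ℕ} (X : BipartiteOp d d) :
    (omegaProj d * X).trace = (1 / d : ℂ) * ∑ i, ∑ j, X (i, i) (j, j) := by
  simp only [trace, diag, mul_apply, Fintype.sum_prod_type, omegaProj_apply, ite_mul, zero_mul,
    ite_and, Finset.mul_sum]
  simp only [Finset.sum_ite_irrel, Finset.sum_const_zero, Finset.sum_ite_eq, Finset.mem_univ,
    if_true]
  exact Finset.sum_comm

theorem trace_omegaProj_mul_ketBra {d : ℕ} (ψ : BipartiteVec d d) :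
    (omegaProj d * ketBra ψ).trace = ((‖(matricize ψ).trace‖ ^ 2 / d : ℝ) : ℂ) := by
  rw [trace_omegaProj_mul]
  have h2 : ∑ i, ∑ j, ketBra ψ (i, i) (j, j) =
      (matricize ψ).trace * star (matricize ψ).trace := by
    simp [ketBra, matricize, trace, Finset.sum_mul_sum]
  rw [h2, ← starRingEnd_apply, Complex.mul_conj, Complex.normSq_eq_norm_sq]
  push_cast
  ring

theorem quadForm_omegaProj {d : ℕ} (ψ : BipartiteVec d d) :
    quadForm (omegaProj d) ψ = ‖(matricize ψ).trace‖ ^ 2 / d := by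
  rw [quadForm, ← trace_mul_ketBra, trace_omegaProj_mul_ketBra, Complex.ofReal_re]

/-- The overlap with `P_ω` is invariant under `U ⊗ Ū`. -/
theorem trace_omegaProj_mul_twirl_conj {d : ℕ} {U : Matrix (Fin d) (Fin d) ℂ}
    (hU : U ∈ unitaryGroup (Fin d) ℂ) (X : BipartiteOp d d) :
    (omegaProj d * (twirl U * X * (twirl U)ᴴ)).trace = (omegaProj d * X).trace := by
  have hω : toEuclideanLin (twirl Uᴴ) (omegaVec d) = omegaVec d := by
    have hmat : matricize (omegaVec d) = ((1 / Real.sqrt d : ℝ) : ℂ) • 1 := by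
      ext i j
      simp [matricize, omegaVec_apply, one_apply]
    have : matricize (toEuclideanLin (twirl Uᴴ) (omegaVec d)) = matricize (omegaVec d) := by
      rw [matricize_twirl, hmat, Matrix.mul_smul, Matrix.mul_one, Matrix.smul_mul,
        conjTranspose_conjTranspose, show Uᴴ * U = 1 from mem_unitaryGroup_iff'.1 hU]
    ext ⟨i, j⟩
    exact congrFun (congrFun this i) j
  have htw : twirl Uᴴ = (twirl U)ᴴ := by
    ext p q
    simp [twirl_apply, conjTranspose_apply, mul_comm]
  have hP : (twirl U)ᴴ * omegaProj d * twirl U = omegaProj d := by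
    have := ketBra_toEuclideanLin (twirl Uᴴ) (omegaVec d)
    rw [hω, htw, conjTranspose_conjTranspose] at this
    exact this.symm
  rw [← Matrix.mul_assoc, trace_mul_comm, ← Matrix.mul_assoc, ← Matrix.mul_assoc, hP]

theorem trace_unitary_conj {n : Type*} [Fintype n] [DecidableEq n] {W : Matrix n n ℂ}
    (hW : W ∈ unitaryGroup n ℂ) (X : Matrix n n ℂ) : (W * X * Wᴴ).trace = X.trace := by
  rw [trace_mul_comm, ← Matrix.mul_assoc, show Wᴴ * W = 1 from mem_unitaryGroup_iff'.1 hW,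
    Matrix.one_mul]

/-! ### The commutant of the unitaries `U ⊗ Ū` -/

/-- `X` is invariant under conjugation by `U ⊗ Ū` for every unitary `U`. -/
def IsTwirlInvariant {d : ℕ} (X : BipartiteOp d d) : Prop :=
  ∀ U ∈ unitaryGroup (Fin d) ℂ, twirl U * X * (twirl U)ᴴ = X

namespace IsTwirlInvariant

variable {d : ℕ} {X : BipartiteOp d d}

theorem commute (hX : IsTwirlInvariant X) {U : Matrix (Fin d) (Fin d) ℂ}
    (hU : U ∈ unitaryGroup (Fin d) ℂ) : twirl U * X = X * twirl U := by
  have h : (twirl U)ᴴ * twirl U = 1 := mem_unitaryGroup_iff'.1 (twirl_mem_unitaryGroup hU)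
  nth_rewrite 2 [← hX U hU]
  rw [Matrix.mul_assoc _ _ (twirl U), h, Matrix.mul_one]

theorem apply_of_diagonal (hX : IsTwirlInvariant X) {z : Fin d → ℂ} (hz : ∀ i, z i * star (z i) = 1)
    (i j k l : Fin d) :
    z i * star (z j) * X (i, j) (k, l) = X (i, j) (k, l) * (z k * star (z l)) := by
  have hU : diagonal z ∈ unitaryGroup (Fin d) ℂ := by
    rw [mem_unitaryGroup_iff, star_eq_conjTranspose, diagonal_conjTranspose, diagonal_mul_diagonal,
      ← diagonal_one]
    congr 1
    exact funext hz
  have htw : twirl (diagonal z) = diagonal fun p : Fin d × Fin d => z p.1 * star (z p.2) := by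
    ext ⟨a, b⟩ ⟨c, e⟩
    simp only [twirl_apply, diagonal_apply, Prod.mk.injEq]
    by_cases h : a = c <;> by_cases h' : b = e <;> simp [h, h']
  have := congrFun (congrFun (hX.commute hU) (i, j)) (k, l)
  rwa [htw, diagonal_mul, mul_diagonal] at this

/-- Invariance under diagonal phases leaves only the entries at `(i, j), (i, j)` and at
`(i, i), (k, k)`: any other entry acquires a factor different from `1` when a suitable basis vector
is multiplied by the imaginary unit. -/
theorem apply_eq_zero (hX : IsTwirlInvariant X) {i j k l : Fin d}
    (h1 : ¬(i = k ∧ j = l)) (h2 : ¬(i = j ∧ k = l)) : X (i, j) (k, l) = 0 := by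
  have hz : ∀ a b : Fin d, (if b = a then Complex.I else 1) * star (if b = a then Complex.I else 1)
      = (1 : ℂ) := by
    intro a b
    split_ifs <;> simp
  have key : ∀ c : ℂ, Complex.I * c = c → c = 0 := by
    intro c hc
    have h3 := congrArg Complex.re hc
    have h4 := congrArg Complex.im hc
    simp only [Complex.mul_re, Complex.mul_im, Complex.I_re, Complex.I_im] at h3 h4
    apply Complex.ext <;> simp <;> linarith
  by_cases hik : i = k
  · subst hik
    have hjl : j ≠ l := fun h => h1 ⟨rfl, h⟩
    by_cases hil : i = l
    · subst hil
      have := hX.apply_of_diagonal (hz j) i j i i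
      simp [hjl.symm] at this
      apply key
      linear_combination -Complex.I * this - X (i, j) (i, i) * Complex.I_sq
    · have := hX.apply_of_diagonal (hz l) i j i l
      simp [hil, hjl] at this
      apply key
      linear_combination Complex.I * this - X (i, j) (i, l) * Complex.I_sq
  · by_cases hij : i = j
    · subst hij
      have hkl : k ≠ l := fun h => h2 ⟨rfl, h⟩
      have := hX.apply_of_diagonal (hz k) i i k l
      simp [hik, hkl.symm] at this
      apply key
      linear_combination -this
    · have := hX.apply_of_diagonal (hz i) i j k l
      by_cases hil : l = i
      · simp [Ne.symm hij, Ne.symm hik, hil] at this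
        subst hil
        have h2I : (2 * Complex.I) * X (l, j) (k, l) = 0 := by linear_combination this
        simpa using h2I
      · simp [Ne.symm hij, Ne.symm hik, hil] at this
        exact key _ this

theorem apply_perm (hX : IsTwirlInvariant X) (σ : Equiv.Perm (Fin d)) (i j k l : Fin d) :
    X (σ i, σ j) (σ k, σ l) = X (i, j) (k, l) := by
  set U : Matrix (Fin d) (Fin d) ℂ := of fun a b => if σ a = b then 1 else 0 with hUdef
  have hU : U ∈ unitaryGroup (Fin d) ℂ := by
    rw [mem_unitaryGroup_iff]
    ext a b
    simp [hUdef, mul_apply, star_apply, one_apply, eq_comm]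
  have := congrFun (congrFun (hX.commute hU) (i, j)) (σ k, σ l)
  simp only [mul_apply, twirl_apply, Fintype.sum_prod_type, hUdef, of_apply,
    EmbeddingLike.apply_eq_iff_eq] at this
  simpa [apply_ite, ite_mul, mul_ite] using this

/-- A unitary mixing `e_i` and `e_j` forces the diagonal entry at `(i, i)` to be the sum of the
other two kinds of entries. -/
theorem apply_diag (hX : IsTwirlInvariant X) {i j : Fin d} (hij : i ≠ j) {A B : ℂ}
    (hA : X (i, j) (i, j) = A) (hB : ∀ l, i ≠ l → X (i, i) (l, l) = B) :
    X (i, i) (i, i) = A + B := by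
  -- the reflection in the hyperplane orthogonal to `v = e_i + 2 e_j`, where `⟪v, v⟫ = 5`
  set v : Fin d → ℂ := Pi.single i 1 + Pi.single j 2 with hv
  have hvi : v i = 1 := by simp [hv, hij]
  have hvj : v j = 2 := by simp [hv, hij.symm]
  have hvstar : ∀ a, star (v a) = v a := by
    intro a
    simp only [hv, Pi.add_apply, Pi.single_apply]
    split_ifs <;> simp
  have hvv : v ⬝ᵥ v = 5 := by
    rw [show v ⬝ᵥ v = v ⬝ᵥ (Pi.single i 1 + Pi.single j 2) from rfl, dotProduct_add,
      dotProduct_single, dotProduct_single, hvi, hvj]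
    norm_num
  set U : Matrix (Fin d) (Fin d) ℂ := 1 - (2 / 5 : ℂ) • vecMulVec v v with hUdef
  have hUstar : star U = U := by
    ext a b
    simp [hUdef, star_apply, vecMulVec_apply, hvstar, one_apply, eq_comm, mul_comm, apply_ite]
  have hU2 : U * U = 1 := by
    have : vecMulVec v v * vecMulVec v v = (5 : ℂ) • vecMulVec v v := by
      rw [vecMulVec_mul_vecMulVec, hvv]
      ext a b
      simp only [vecMulVec_apply, Matrix.smul_apply, Pi.smul_apply, smul_eq_mul]
      ring
    rw [hUdef, Matrix.sub_mul, Matrix.mul_sub, Matrix.mul_one, Matrix.one_mul, Matrix.smul_mul,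
      Matrix.mul_sub, Matrix.mul_smul, Matrix.mul_one, this]
    module
  have hU : U ∈ unitaryGroup (Fin d) ℂ := by rw [mem_unitaryGroup_iff, hUstar, hU2]
  have hconj : ∀ a b, star (U a b) = U b a := fun a b => congrFun (congrFun hUstar b) a
  have horth : ∑ a, U a i * U j a = 0 := by
    have := congrFun (congrFun hU2 j) i
    rw [mul_apply, one_apply_ne hij.symm] at this
    rw [← this]
    exact Finset.sum_congr rfl fun _ _ => mul_comm _ _
  have hUii : U i i = 3 / 5 := by
    simp [hUdef, vecMulVec_apply, hvi]; norm_num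
  have hUji : U j i = -4 / 5 := by
    simp [hUdef, vecMulVec_apply, hvi, hvj, one_apply, hij.symm]; norm_num
  -- compare the entries at `(i, i), (i, j)` of the two products: the left one reduces to the single
  -- term with `A`, the right one is evaluated with the orthogonality of the columns `i` and `j`
  have := congrFun (congrFun (hX.commute hU) (i, i)) (i, j)
  simp only [mul_apply, twirl_apply, Fintype.sum_prod_type, hconj] at this
  rw [Finset.sum_eq_single i, Finset.sum_eq_single j] at this
  · have hrhs : ∑ a, ∑ b, X (i, i) (a, b) * (U a i * U j b) =
        ∑ a, X (i, i) (a, a) * (U a i * U j a) := by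
      refine Finset.sum_congr rfl fun a _ => Finset.sum_eq_single a ?_ (by simp)
      intro b _ hb
      rw [hX.apply_eq_zero (by rintro ⟨rfl, rfl⟩; exact hb rfl) (fun h => hb h.2.symm), zero_mul]
    have hsum : ∑ a, X (i, i) (a, a) * (U a i * U j a) =
        ∑ a, B * (U a i * U j a) + (X (i, i) (i, i) - B) * (U i i * U j i) := by
      rw [← Finset.sum_erase_add _ _ (Finset.mem_univ i),
        ← Finset.sum_erase_add (f := fun a => B * (U a i * U j a)) _ (Finset.mem_univ i)]
      rw [Finset.sum_congr rfl fun a ha => by rw [hB a (Finset.ne_of_mem_erase ha).symm]]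
      ring
    rw [hrhs, hsum, ← Finset.mul_sum, horth, hA, hUii, hUji] at this
    linear_combination (25 / 12 : ℂ) * this
  · intro b _ hb
    rw [hX.apply_eq_zero (fun h => hb h.2) (fun h => hij h.2), mul_zero]
  · simp
  · intro a _ ha
    refine Finset.sum_eq_zero fun b _ => ?_
    rw [hX.apply_eq_zero (fun h => ha h.1) (fun h => hij h.2), mul_zero]
  · simp

/-- The operators invariant under all `U ⊗ Ū` are the combinations of `1` and `P_ω`. -/
theorem exists_eq_smul_one_add_smul_omegaProj (hd : 2 ≤ d) (hX : IsTwirlInvariant X) :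
    ∃ a b : ℂ, X = a • 1 + b • omegaProj d := by
  have h2 : ∀ {a b c e : Fin d}, a ≠ b → c ≠ e → ∃ σ : Equiv.Perm (Fin d), σ • a = c ∧ σ • b = e :=
    (MulAction.is_two_pretransitive_iff (G := Equiv.Perm (Fin d)) (α := Fin d)).1
    (Equiv.Perm.isMultiplyPretransitive (Fin d) 2)
  let i₀ : Fin d := ⟨0, by omega⟩
  let i₁ : Fin d := ⟨1, by omega⟩
  have h01 : i₀ ≠ i₁ := by simp [i₀, i₁]
  have hA : ∀ i j, i ≠ j → X (i, j) (i, j) = X (i₀, i₁) (i₀, i₁) := by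
    intro i j hij
    obtain ⟨σ, rfl, rfl⟩ := h2 h01 hij
    exact hX.apply_perm σ _ _ _ _
  have hB : ∀ i j, i ≠ j → X (i, i) (j, j) = X (i₀, i₀) (i₁, i₁) := by
    intro i j hij
    obtain ⟨σ, rfl, rfl⟩ := h2 h01 hij
    exact hX.apply_perm σ _ _ _ _
  have hC : ∀ i, X (i, i) (i, i) = X (i₀, i₁) (i₀, i₁) + X (i₀, i₀) (i₁, i₁) := by
    intro i
    have : Nontrivial (Fin d) := ⟨i₀, i₁, h01⟩
    obtain ⟨j, hj⟩ := exists_ne i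
    exact hX.apply_diag hj.symm (hA i j hj.symm) (hB i)
  refine ⟨X (i₀, i₁) (i₀, i₁), d * X (i₀, i₀) (i₁, i₁), ?_⟩
  have hd0 : (d : ℂ) ≠ 0 := by
    rw [Nat.cast_ne_zero]; omega
  ext ⟨i, j⟩ ⟨k, l⟩
  simp only [Matrix.add_apply, Matrix.smul_apply, smul_eq_mul, omegaProj_apply, one_apply,
    Prod.mk.injEq]
  by_cases h1 : i = k ∧ j = l
  · obtain ⟨rfl, rfl⟩ := h1
    by_cases hij : i = j
    · subst hij
      simp [hC]
      field_simp
    · simp [hij, hA i j hij]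
  · by_cases h2 : i = j ∧ k = l
    · obtain ⟨rfl, rfl⟩ := h2
      have hik : i ≠ k := fun h => h1 ⟨h, h⟩
      simp [hik, hB i k hik]
      field_simp
    · rw [hX.apply_eq_zero h1 h2, if_neg h1, if_neg h2]
      simp

end IsTwirlInvariant

/-! ### Averaging by minimal norm -/

/-- The point of minimal norm in a closed convex set is the only one with its norm. Hence every
norm-preserving self-map of the set fixes it. -/
theorem exists_mem_forall_norm_eq {E : Type*} [NormedAddCommGroup E] [InnerProductSpace ℝ E]
    [CompleteSpace E] {K : Set E} (hne : K.Nonempty) (hcl : IsClosed K) (hconv : Convex ℝ K) :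
    ∃ x ∈ K, ∀ y ∈ K, ‖y‖ = ‖x‖ → y = x := by
  obtain ⟨x, hx, hmin⟩ := exists_norm_eq_iInf_of_complete_convex hne hcl.isComplete hconv 0
  have hle := (norm_eq_iInf_iff_real_inner_le_zero hconv hx).1 hmin
  refine ⟨x, hx, fun y hy hyx => ?_⟩
  have h1 := hle y hy
  have h2 : ‖y - x‖ ^ 2 = ‖y‖ ^ 2 - 2 * inner ℝ y x + ‖x‖ ^ 2 := norm_sub_sq_real y x
  rw [zero_sub, inner_sub_right, inner_neg_left, inner_neg_left, real_inner_self_eq_norm_sq,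
    real_inner_comm] at h1
  have h3 : ‖y - x‖ ^ 2 ≤ 0 := by rw [h2, hyx]; linarith
  have h4 : ‖y - x‖ = 0 := (pow_eq_zero_iff two_ne_zero).1 (le_antisymm h3 (sq_nonneg _))
  exact sub_eq_zero.1 (norm_eq_zero.1 h4)

/-- A nonempty closed convex set of matrices contains a matrix fixed by all the unitary
conjugations that preserve the set. -/
theorem exists_mem_unitary_conj_fixed {n : Type*} [Fintype n] [DecidableEq n]
    {S : Set (Matrix n n ℂ)} (hne : S.Nonempty) (hcl : IsClosed S) (hconv : Convex ℝ S) :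
    ∃ X ∈ S, ∀ W ∈ unitaryGroup n ℂ, (∀ Y ∈ S, W * Y * Wᴴ ∈ S) → W * X * Wᴴ = X := by
  let e : EuclideanSpace ℂ (n × n) →ₗ[ℝ] Matrix n n ℂ :=
    { toFun := fun y => of fun i j => y (i, j)
      map_add' := fun _ _ => rfl
      map_smul' := fun _ _ => rfl }
  have hcont : Continuous e := by
    refine continuous_matrix fun i j => ?_
    change Continuous fun y : EuclideanSpace ℂ (n × n) => y (i, j)
    fun_prop
  have he : ∀ X : Matrix n n ℂ, e (WithLp.toLp 2 fun p => X p.1 p.2) = X := fun X => rfl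
  have hnorm : ∀ y, ((‖y‖ ^ 2 : ℝ) : ℂ) = ((e y)ᴴ * e y).trace := by
    intro y
    rw [EuclideanSpace.norm_sq_eq, Fintype.sum_prod_type, Finset.sum_comm]
    simp only [trace, diag, mul_apply, conjTranspose_apply, Complex.ofReal_sum]
    refine Finset.sum_congr rfl fun i _ => Finset.sum_congr rfl fun j _ => ?_
    rw [mul_comm, ← starRingEnd_apply, Complex.mul_conj, Complex.normSq_eq_norm_sq]
    rfl
  obtain ⟨x, hx, hfix⟩ := exists_mem_forall_norm_eq (K := e ⁻¹' S)
    (hne.elim fun X hX => ⟨_, (he X).symm ▸ hX⟩) (hcl.preimage hcont)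
    (hconv.linear_preimage e)
  refine ⟨e x, hx, fun W hW hS => ?_⟩
  set y : EuclideanSpace ℂ (n × n) := WithLp.toLp 2 fun p => (W * e x * Wᴴ) p.1 p.2
  have hy : e y = W * e x * Wᴴ := he _
  have hyx : ‖y‖ = ‖x‖ := by
    rw [← sq_eq_sq₀ (norm_nonneg _) (norm_nonneg _), ← Complex.ofReal_inj, hnorm, hnorm, hy,
      ← trace_unitary_conj hW ((e x)ᴴ * e x), conjTranspose_mul, conjTranspose_mul,
      conjTranspose_conjTranspose]
    have hW' : Wᴴ * W = 1 := mem_unitaryGroup_iff'.1 hW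
    congr 1
    calc _ = W * ((e x)ᴴ * ((Wᴴ * W) * (e x * Wᴴ))) := by simp only [Matrix.mul_assoc]
      _ = _ := by rw [hW', Matrix.one_mul]; simp only [Matrix.mul_assoc]
  rw [← hy, hfix y (by rw [Set.mem_preimage, hy]; exact hS _ hx) hyx]

/-! ### Isotropic states in the cone -/

section Isotropic

variable {d : ℕ}

theorem trace_omegaProj (hd : d ≠ 0) : (omegaProj d).trace = 1 := by
  have : (d : ℂ) ≠ 0 := Nat.cast_ne_zero.2 hd
  have h := trace_omegaProj_mul (d := d) 1
  rw [Matrix.mul_one] at h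
  rw [h]
  simp [one_apply, this]

theorem trace_omegaProj_mul_self (hd : d ≠ 0) : (omegaProj d * omegaProj d).trace = 1 := by
  have : (d : ℂ) ≠ 0 := Nat.cast_ne_zero.2 hd
  rw [trace_omegaProj_mul]
  simp [omegaProj_apply, this]

theorem sq_sub_one_ne_zero_of_two_le (hd : 2 ≤ d) : (d : ℂ) ^ 2 - 1 ≠ 0 := by
  have : (2 : ℝ) ≤ d := by exact_mod_cast hd
  have h : (d : ℝ) ^ 2 - 1 ≠ 0 := by nlinarith
  exact_mod_cast h

theorem trace_isotropicState (hd : 2 ≤ d) (F : ℝ) : (isotropicState d F).trace = 1 := by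
  have h1 := sq_sub_one_ne_zero_of_two_le hd
  simp only [isotropicState, trace_add, trace_smul, trace_sub, trace_omegaProj (by omega : d ≠ 0),
    trace_one, Fintype.card_prod, Fintype.card_fin, Complex.real_smul]
  push_cast
  field_simp
  ring

theorem trace_omegaProj_mul_isotropicState (hd : 2 ≤ d) (F : ℝ) :
    (omegaProj d * isotropicState d F).trace = F := by
  simp only [isotropicState, Matrix.mul_add, Matrix.mul_smul, Matrix.mul_sub, Matrix.mul_one,
    trace_add, trace_smul, trace_sub, trace_omegaProj (by omega : d ≠ 0),
    trace_omegaProj_mul_self (by omega : d ≠ 0), Complex.real_smul]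
  ring

theorem isotropicState_combo (F G t : ℝ) :
    (1 - t) • isotropicState d F + t • isotropicState d G =
      isotropicState d ((1 - t) * F + t * G) := by
  simp only [isotropicState]
  module

/-- An operator invariant under all `U ⊗ Ū`, of trace one and with `tr (P_ω X) = F`, is `ρ_F`. -/
theorem IsTwirlInvariant.eq_isotropicState (hd : 2 ≤ d) {X : BipartiteOp d d}
    (hX : IsTwirlInvariant X) (h1 : X.trace = 1) {F : ℝ} (hF : (omegaProj d * X).trace = F) :
    X = isotropicState d F := by
  obtain ⟨a, b, rfl⟩ := hX.exists_eq_smul_one_add_smul_omegaProj hd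
  have hd0 : d ≠ 0 := by omega
  have hd1 := sq_sub_one_ne_zero_of_two_le hd
  simp only [Matrix.mul_add, Matrix.mul_smul, trace_add, trace_smul,
    trace_omegaProj hd0, trace_omegaProj_mul_self hd0, trace_one, Fintype.card_prod,
    Fintype.card_fin, smul_eq_mul, mul_one] at h1 hF
  push_cast at h1
  have ha : a = ((1 - F) / ((d : ℝ) ^ 2 - 1) : ℝ) := by
    push_cast
    rw [eq_div_iff hd1]
    linear_combination h1 - hF
  have hb : b = F - a := by linear_combination hF
  rw [hb, ha]
  ext p q
  simp only [isotropicState, Matrix.add_apply, Matrix.sub_apply, Matrix.smul_apply, smul_eq_mul,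
    Complex.real_smul]
  ring

/-- The twirl of an admissible pure state is the isotropic state with the same overlap, and it lies
in the cone. The slice of the cone given by trace one and the prescribed overlap with `P_ω` is
invariant under all `U ⊗ Ū`, so its point of minimal Hilbert-Schmidt norm is isotropic. -/
theorem isotropicState_quadForm_mem_superpositiveCone (hd : 2 ≤ d) {α : ℝ} {ψ : BipartiteVec d d}
    (hψ : ψ ∈ admissible d d α) :
    isotropicState d (quadForm (omegaProj d) ψ) ∈ superpositiveCone d d α := by
  set F := quadForm (omegaProj d) ψ with hF
  let S : Set (BipartiteOp d d) :=
    superpositiveCone d d α ∩ {X | X.trace = 1 ∧ (omegaProj d * X).trace = F}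
  have hcl : IsClosed S := by
    refine isClosed_closure.inter (IsClosed.inter ?_ ?_)
    · exact isClosed_eq (by fun_prop) continuous_const
    · exact isClosed_eq (by fun_prop) continuous_const
  have hconv : Convex ℝ S := by
    refine (convex_superpositiveCone α).inter ?_
    rintro X ⟨hX1, hX2⟩ Y ⟨hY1, hY2⟩ a b - - hab
    have hab' : (a : ℂ) + b = 1 := by exact_mod_cast hab
    constructor
    · rw [trace_add, trace_smul, trace_smul, hX1, hY1, Complex.real_smul, Complex.real_smul]
      linear_combination hab'
    · rw [Matrix.mul_add, trace_add, Matrix.mul_smul, Matrix.mul_smul, trace_smul, trace_smul, hX2,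
        hY2, Complex.real_smul, Complex.real_smul]
      linear_combination (F : ℂ) * hab'
  have hne : S.Nonempty := by
    refine ⟨ketBra ψ, ketBra_mem_superpositiveCone hψ, ?_, ?_⟩
    · rw [trace_ketBra, hψ.1]
      simp
    · rw [hF, trace_omegaProj_mul_ketBra, quadForm_omegaProj]
  obtain ⟨X, ⟨hXK, hX1, hXF⟩, hfix⟩ := exists_mem_unitary_conj_fixed hne hcl hconv
  have hX : IsTwirlInvariant X := by
    intro U hU
    refine hfix _ (twirl_mem_unitaryGroup hU) fun Y hY => ?_
    refine ⟨twirl_conj_mem_superpositiveCone hU hY.1, ?_, ?_⟩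
    · rw [trace_unitary_conj (twirl_mem_unitaryGroup hU), hY.2.1]
    · rw [trace_omegaProj_mul_twirl_conj hU, hY.2.2]
  rwa [← hX.eq_isotropicState hd hX1 hXF]

/-- A bound on the overlap of admissible vectors with `ω` extends by linearity and continuity to
the isotropic states in the cone. -/
theorem le_of_isotropicState_mem_superpositiveCone (hd : 2 ≤ d) {α c F : ℝ}
    (hc : ∀ ψ ∈ admissible d d α, quadForm (omegaProj d) ψ ≤ c)
    (h : isotropicState d F ∈ superpositiveCone d d α) : F ≤ c := by
  have hcl : IsClosed {X : BipartiteOp d d | (omegaProj d * X).trace.re ≤ c * X.trace.re} :=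
    isClosed_le (by fun_prop) (by fun_prop)
  have hsub : superpositiveCone d d α ⊆ {X | (omegaProj d * X).trace.re ≤ c * X.trace.re} := by
    refine closure_minimal (fun Y hY => ?_) hcl
    refine Submodule.span_induction (p := fun Y _ => (omegaProj d * Y).trace.re ≤ c * Y.trace.re)
      ?_ ?_ ?_ ?_ hY
    · rintro _ ⟨ψ, hψ, rfl⟩
      have := hc ψ hψ
      rw [trace_ketBra, hψ.1, trace_mul_ketBra]
      rw [quadForm] at this
      simpa only [one_pow, Complex.ofReal_one, Complex.one_re, mul_one] using this
    · simp
    · intro x y _ _ hx hy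
      rw [Matrix.mul_add, trace_add, trace_add, Complex.add_re, Complex.add_re]
      linarith
    · rintro ⟨a, ha⟩ x _ hx
      change (omegaProj d * (a • x)).trace.re ≤ c * (a • x).trace.re
      rw [Matrix.mul_smul, trace_smul, trace_smul, Complex.smul_re, Complex.smul_re, smul_eq_mul,
        smul_eq_mul]
      have := mul_le_mul_of_nonneg_left hx ha
      linarith
  have := hsub h
  rw [Set.mem_ofPred_eq, trace_omegaProj_mul_isotropicState hd, trace_isotropicState hd] at this
  simpa using this

/-- The product vector `e₁ ⊗ e₂` is admissible at every level and orthogonal to `ω`. -/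
theorem exists_mem_admissible_quadForm_eq_zero (hd : 2 ≤ d) {α : ℝ} (hα : 1 ≤ α) :
    ∃ ψ ∈ admissible d d α, quadForm (omegaProj d) ψ = 0 := by
  let i₀ : Fin d := ⟨0, by omega⟩
  let i₁ : Fin d := ⟨1, by omega⟩
  have h01 : i₀ ≠ i₁ := by simp [i₀, i₁]
  let ψ : BipartiteVec d d := EuclideanSpace.single (i₀, i₁) 1
  have hmat : matricize ψ = vecMulVec (Pi.single i₀ 1) (Pi.single i₁ 1) := by
    ext i j
    simp only [matricize, of_apply, ψ, PiLp.single_apply, vecMulVec_apply, Pi.single_apply,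
      Prod.mk.injEq, ite_and]
    split_ifs <;> simp
  have hrank : Module.finrank ℂ (toEuclideanLin (matricize ψ)).range ≤ 1 := by
    rw [hmat, toEuclideanLin_eq_toLin_orthonormal, ← rank_eq_finrank_range_toLin]
    exact rank_vecMulVec_le _ _
  have hs : ∀ j, 1 ≤ j → schmidtCoeff ψ j = 0 := fun j hj =>
    LinearMap.singularValues_eq_zero_iff_le_finrank_range _ |>.2 (hrank.trans hj)
  refine ⟨ψ, ⟨by simp [ψ], fun j hj => hs j ?_, fun hθ => ?_⟩, ?_⟩
  · exact (Nat.one_le_ceil_iff.2 (by linarith)).trans hj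
  · rw [hs _ ((Nat.one_le_floor_iff _).2 hα)]
    exact mul_nonneg (div_nonneg hθ.le (Nat.cast_nonneg _))
      (Finset.sum_nonneg fun _ _ => schmidtCoeff_nonneg _ _)
  · rw [quadForm_omegaProj, hmat, trace_vecMulVec]
    simp [h01]

/-- Below the overlap of an admissible vector, all isotropic states lie in the cone: they are
mixtures of the one with that overlap and the one with overlap zero. -/
theorem isotropicState_mem_superpositiveCone (hd : 2 ≤ d) {α : ℝ} (hα : 1 ≤ α)
    {ψ : BipartiteVec d d} (hψ : ψ ∈ admissible d d α) {F : ℝ} (hF0 : 0 ≤ F)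
    (hF : F ≤ quadForm (omegaProj d) ψ) :
    isotropicState d F ∈ superpositiveCone d d α := by
  obtain ⟨φ, hφ, h0⟩ := exists_mem_admissible_quadForm_eq_zero hd hα
  have hφ' := isotropicState_quadForm_mem_superpositiveCone hd hφ
  rcases hF0.eq_or_lt with rfl | hpos
  · rwa [h0] at hφ'
  · have hψ' := isotropicState_quadForm_mem_superpositiveCone hd hψ
    have hq : 0 < quadForm (omegaProj d) ψ := hpos.trans_le hF
    have ht1 : F / quadForm (omegaProj d) ψ ≤ 1 := (div_le_one hq).2 hF
    have := convex_superpositiveCone α hφ' hψ' (sub_nonneg.2 ht1) (by positivity : 0 ≤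
      F / quadForm (omegaProj d) ψ) (by ring)
    rw [isotropicState_combo, h0, mul_zero, zero_add, div_mul_cancel₀ _ hq.ne'] at this
    exact this

end Isotropic

/-! ### The profile -/

/-- Sums over the first `d` coefficients reduce to the first `k + 1`. For `k = d` the last of these,
`f d`, is itself zero. -/
theorem sum_range_of_eq_zero {f : ℕ → ℝ} {k d : ℕ} (hkd : k ≤ d) (hk : ∀ j, k + 1 ≤ j → f j = 0)
    (hd : f d = 0) : ∑ j ∈ Finset.range d, f j = ∑ j ∈ Finset.range k, f j + f k := by
  rw [← Finset.sum_range_succ, ← add_zero (∑ j ∈ Finset.range d, f j), ← hd,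
    ← Finset.sum_range_succ]
  symm
  refine Finset.sum_subset (Finset.range_mono (by omega)) fun j _ hj => hk j ?_
  simpa using hj

/-- With `S` the sum of `k` numbers of which the sum of squares is at most `1 - x ^ 2`, the
constraint `x ≤ θ S / k` bounds `S + x`. Cauchy-Schwarz gives `S ^ 2 / k + x ^ 2 ≤ 1`; with
`x = t S / k` the claim is that `(k + t) ^ 2 / (k + t ^ 2)` increases in `t ∈ [0, 1]`. -/
theorem sq_add_le_of_le_mul_div {k θ S x : ℝ} (hk : 1 ≤ k) (hθ0 : 0 ≤ θ) (hθ1 : θ ≤ 1)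
    (hS : 0 ≤ S) (hx : 0 ≤ x) (hnorm : S ^ 2 / k + x ^ 2 ≤ 1) (hxS : x ≤ θ / k * S) :
    (S + x) ^ 2 ≤ (k + θ) ^ 2 / (k + θ ^ 2) := by
  have hk0 : 0 < k := by linarith
  rw [le_div_iff₀ (by positivity)]
  set u := S / k with hu
  have hSu : S = k * u := by rw [hu]; field_simp
  have hu0 : 0 ≤ u := by positivity
  have h1 : k * u ^ 2 + x ^ 2 ≤ 1 := by
    have : S ^ 2 / k = k * u ^ 2 := by rw [hSu]; field_simp
    rwa [this] at hnorm
  have h2 : x ≤ θ * u := by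
    have : θ / k * S = θ * u := by rw [hu]; ring
    rwa [this] at hxS
  have key : (S + x) ^ 2 * (k + θ ^ 2) ≤ (k + θ) ^ 2 * (k * u ^ 2 + x ^ 2) := by
    rw [hSu]
    have hθu : θ * u ≤ u := mul_le_of_le_one_left hu0 hθ1
    have hθx : θ * x ≤ u := (mul_le_of_le_one_left hx hθ1).trans (h2.trans hθu)
    have h3 : (k - 1) * (θ * u + x) ≤ (k - 1) * (2 * u) :=
      mul_le_mul_of_nonneg_left (by linarith) (by linarith)
    -- `k` times this product is the difference of the two sides
    have h4 : 0 ≤ (θ * u - x) * (2 * k * u - (k - 1) * (θ * u + x) - 2 * (θ * x)) :=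
      mul_nonneg (by linarith) (by linarith)
    linear_combination k * h4
  calc _ ≤ _ := key
    _ ≤ (k + θ) ^ 2 * 1 := by gcongr
    _ = _ := mul_one _

/-- The upper bound for the overlap: `|tr A|` is at most the sum of the Schmidt coefficients, and
the admissibility constraint bounds that sum. -/
theorem quadForm_omegaProj_le {d : ℕ} {α : ℝ} (hα : 1 ≤ α) (hαd : α ≤ d) {k : ℕ} {θ : ℝ}
    (hk : k = ⌊α⌋₊) (hθ : θ = α - k) {ψ : BipartiteVec d d} (hψ : ψ ∈ admissible d d α) :
    quadForm (omegaProj d) ψ ≤ (k + θ) ^ 2 / (d * (k + θ ^ 2)) := by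
  obtain ⟨hnorm, hvan, hlast⟩ := hψ
  have hα0 : 0 ≤ α := by linarith
  have hk1 : 1 ≤ k := hk ▸ (Nat.one_le_floor_iff _).2 hα
  have hkα : (k : ℝ) ≤ α := hk ▸ Nat.floor_le hα0
  have hαk : α < k + 1 := hk ▸ Nat.lt_floor_add_one α
  have hkd : k ≤ d := by exact_mod_cast hkα.trans hαd
  have hk1' : (1 : ℝ) ≤ k := by exact_mod_cast hk1
  have hd0 : (0 : ℝ) < d := by linarith
  set s := schmidtCoeff ψ with hs
  have hs0 : ∀ j, 0 ≤ s j := schmidtCoeff_nonneg ψ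
  have hsd : s d = 0 := schmidtCoeff_of_le ψ le_rfl
  have hsk : ∀ j, k + 1 ≤ j → s j = 0 := fun j hj => hvan j <| by
    rw [Nat.ceil_le]
    have : ((k + 1 : ℕ) : ℝ) ≤ j := by exact_mod_cast hj
    push_cast at this
    linarith
  -- the constraint on the last coefficient also holds for integer `α`, when that coefficient is zero
  have hlast' : s k ≤ θ / k * ∑ j ∈ Finset.range k, s j := by
    rcases hkα.eq_or_lt with h | h
    · have hθ0 : θ = 0 := by rw [hθ, h, sub_self]
      rw [hθ0, zero_div, zero_mul]
      refine (hvan k ?_).le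
      rw [Nat.ceil_le, h]
    · have := hlast (by rw [← hk]; linarith)
      rwa [← hk, ← hθ] at this
  have hsum : ∑ j ∈ Finset.range d, s j = ∑ j ∈ Finset.range k, s j + s k :=
    sum_range_of_eq_zero hkd hsk hsd
  have hsq : ∑ j ∈ Finset.range k, s j ^ 2 + s k ^ 2 = 1 := by
    rw [← sum_range_of_eq_zero (f := fun j => s j ^ 2) hkd (fun j hj => by simp [hsk j hj])
      (by simp [hsd]), ← norm_sq_eq_sum_schmidtCoeff_sq, hnorm, one_pow]
  have hcs : (∑ j ∈ Finset.range k, s j) ^ 2 / k ≤ ∑ j ∈ Finset.range k, s j ^ 2 := by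
    rw [div_le_iff₀ (by linarith), mul_comm]
    simpa using sq_sum_le_card_mul_sum_sq (s := Finset.range k) (f := s)
  have hbound : (∑ j ∈ Finset.range d, s j) ^ 2 ≤ (k + θ) ^ 2 / (k + θ ^ 2) := by
    rw [hsum]
    exact sq_add_le_of_le_mul_div hk1' (by linarith) (by linarith)
      (Finset.sum_nonneg fun j _ => hs0 j) (hs0 k) (by linarith) hlast'
  rw [quadForm_omegaProj, mul_comm (d : ℝ), ← div_div]
  gcongr
  exact (pow_le_pow_left₀ (norm_nonneg _) (norm_trace_matricize_le ψ) 2).trans hbound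

/-- Equality holds for the diagonal vector whose coefficients are proportional to
`1, …, 1, θ, 0, …, 0`. -/
theorem exists_mem_admissible_maximizer {d : ℕ} {α : ℝ} (hα : 1 ≤ α) (hαd : α ≤ d) {k : ℕ}
    {θ : ℝ} (hk : k = ⌊α⌋₊) (hθ : θ = α - k) :
    ∃ ψ ∈ admissible d d α,
      quadForm (omegaProj d) ψ = (k + θ) ^ 2 / (d * (k + θ ^ 2)) ∧
      (∀ j < k, schmidtCoeff ψ j = 1 / Real.sqrt (k + θ ^ 2)) ∧
      schmidtCoeff ψ k = θ / Real.sqrt (k + θ ^ 2) ∧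
      ∀ j, k + 1 ≤ j → schmidtCoeff ψ j = 0 := by
  have hα0 : 0 ≤ α := by linarith
  have hk1 : 1 ≤ k := hk ▸ (Nat.one_le_floor_iff _).2 hα
  have hkα : (k : ℝ) ≤ α := hk ▸ Nat.floor_le hα0
  have hαk : α < k + 1 := hk ▸ Nat.lt_floor_add_one α
  have hkd : k ≤ d := by exact_mod_cast hkα.trans hαd
  have hk1' : (1 : ℝ) ≤ k := by exact_mod_cast hk1
  have hθ0 : 0 ≤ θ := by linarith
  have hθ1 : θ ≤ 1 := by linarith
  have hN : 0 < (k : ℝ) + θ ^ 2 := by positivity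
  set N := Real.sqrt (k + θ ^ 2) with hNdef
  have hN0 : 0 < N := Real.sqrt_pos.2 hN
  have hNsq : N ^ 2 = k + θ ^ 2 := Real.sq_sqrt hN.le
  let g : ℕ → ℝ := fun j => if j < k then 1 / N else if j = k then θ / N else 0
  have hglt : ∀ j < k, g j = 1 / N := fun j hj => if_pos hj
  have hgk : g k = θ / N := by simp [g]
  have hggt : ∀ j, k + 1 ≤ j → g j = 0 := fun j hj => by
    simp [g, show ¬ j < k by omega, show j ≠ k by omega]
  have hg0 : ∀ j, 0 ≤ g j := fun j => by
    simp only [g]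
    split_ifs <;> positivity
  have hganti : Antitone g := by
    refine antitone_nat_of_succ_le fun j => ?_
    rcases lt_trichotomy (j + 1) k with h | h | h
    · rw [hglt _ h, hglt j (by omega)]
    · rw [h, hgk, hglt j (by omega)]
      gcongr
    · rw [hggt _ (by omega)]
      exact hg0 j
  have hgd : g d = 0 := by
    rcases hkd.eq_or_lt with h | h
    · have : θ = 0 := le_antisymm (by rw [hθ, h]; linarith) hθ0
      rw [← h, hgk, this, zero_div]
    · exact hggt d h
  have hgsum : ∑ j ∈ Finset.range k, g j = k / N := by
    rw [Finset.sum_congr rfl fun j hj => hglt j (Finset.mem_range.1 hj)]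
    simp [div_eq_mul_inv]
  have hgtot : ∑ j ∈ Finset.range d, g j = (k + θ) / N := by
    rw [sum_range_of_eq_zero hkd hggt hgd, hgsum, hgk, add_div]
  have hgsq : ∑ j ∈ Finset.range d, g j ^ 2 = 1 := by
    rw [sum_range_of_eq_zero (f := fun j => g j ^ 2) hkd (fun j hj => by simp [hggt j hj])
      (by simp [hgd]), Finset.sum_congr rfl fun j hj => by rw [hglt j (Finset.mem_range.1 hj)], hgk,
      Finset.sum_const, Finset.card_range, nsmul_eq_mul, div_pow, div_pow, hNsq]
    field_simp
  let ψ : BipartiteVec d d :=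
    WithLp.toLp 2 fun p => diagonal (fun i : Fin d => (g i : ℂ)) p.1 p.2
  have hmat : matricize ψ = diagonal fun i : Fin d => (g i : ℂ) := rfl
  have hsg : ∀ j, schmidtCoeff ψ j = g j := fun j => by
    rcases lt_or_ge j d with h | h
    · exact schmidtCoeff_of_matricize_eq_diagonal hganti hg0 hmat h
    · rw [schmidtCoeff_of_le ψ h]
      exact le_antisymm (hg0 j) (hgd ▸ hganti h)
  have hnorm : ‖ψ‖ = 1 := by
    rw [← sq_eq_sq₀ (norm_nonneg _) zero_le_one, norm_sq_eq_sum_schmidtCoeff_sq, one_pow, ← hgsq]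
    exact Finset.sum_congr rfl fun j _ => by rw [hsg]
  refine ⟨ψ, ⟨hnorm, fun j hj => ?_, fun _ => ?_⟩, ?_, fun j hj => ?_, ?_, fun j hj => ?_⟩
  · have hαj : α ≤ j := Nat.ceil_le.1 hj
    have hkj : k ≤ j := by exact_mod_cast hkα.trans hαj
    rw [hsg]
    rcases hkj.eq_or_lt with h | h
    · have : θ = 0 := le_antisymm (by rw [hθ, h]; linarith) hθ0
      rw [← h, hgk, this, zero_div]
    · exact hggt j h
  · rw [← hk, ← hθ, Finset.sum_congr rfl fun j _ => hsg j, hsg, hgk, hgsum]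
    refine le_of_eq ?_
    field_simp
  · have htr : (matricize ψ).trace = ((k + θ) / N : ℝ) := by
      rw [hmat, trace_diagonal, ← hgtot, Finset.sum_range, Complex.ofReal_sum]
    rw [quadForm_omegaProj, htr, Complex.norm_real, Real.norm_eq_abs, sq_abs, div_pow, hNsq,
      div_div, mul_comm (d : ℝ)]
  · rw [hsg, hglt j hj]
  · rw [hsg, hgk]
  · rw [hsg, hggt j hj]

theorem isGreatest_quadForm_omegaProj {d : ℕ} {α : ℝ} (hα : 1 ≤ α) (hαd : α ≤ d) {k : ℕ} {θ : ℝ}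
    (hk : k = ⌊α⌋₊) (hθ : θ = α - k) :
    IsGreatest (quadForm (omegaProj d) '' admissible d d α)
      ((k + θ) ^ 2 / (d * (k + θ ^ 2))) := by
  obtain ⟨ψ, hψ, hq, -⟩ := exists_mem_admissible_maximizer hα hαd hk hθ
  refine ⟨⟨ψ, hψ, hq⟩, ?_⟩
  rintro _ ⟨φ, hφ, rfl⟩
  exact quadForm_omegaProj_le hα hαd hk hθ hφ

theorem profile_eq {d : ℕ} {α : ℝ} (hα : 1 ≤ α) (hαd : α ≤ d) {k : ℕ} {θ : ℝ}
    (hk : k = ⌊α⌋₊) (hθ : θ = α - k) :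
    profile d α = (k + θ) ^ 2 / (d * (k + θ ^ 2)) :=
  (isGreatest_quadForm_omegaProj hα hαd hk hθ).csSup_eq

theorem isotropicState_mem_superpositiveCone_iff {d : ℕ} (hd : 2 ≤ d) {α : ℝ} (hα : 1 ≤ α)
    (hαd : α ≤ d) {F : ℝ} (hF : 0 ≤ F) :
    isotropicState d F ∈ superpositiveCone d d α ↔ F ≤ profile d α := by
  rw [profile_eq hα hαd rfl rfl]
  obtain ⟨ψ, hψ, hq, -⟩ := exists_mem_admissible_maximizer hα hαd rfl rfl
  refine ⟨fun h => ?_, fun h => ?_⟩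
  · exact le_of_isotropicState_mem_superpositiveCone hd
      (fun φ hφ => quadForm_omegaProj_le hα hαd rfl rfl hφ) h
  · exact isotropicState_mem_superpositiveCone hd hα hψ hF (h.trans_eq hq.symm)

theorem profile_natCast {d k : ℕ} (hk : 1 ≤ k) (hkd : k ≤ d) : profile d k = k / d := by
  have hk' : (1 : ℝ) ≤ k := by exact_mod_cast hk
  have hkd' : (k : ℝ) ≤ d := by exact_mod_cast hkd
  have hd : (0 : ℝ) < d := by linarith
  rw [profile_eq (k := k) (θ := 0) hk' hkd' (Nat.floor_natCast k).symm (sub_self _).symm]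
  field_simp
  ring

end FractionalPositivity

theorem mainTheorem3 (d : ℕ) (hd : 2 ≤ d) :
    (∀ α : ℝ, 1 ≤ α → α ≤ d → ∀ (k : ℕ) (θ : ℝ), k = ⌊α⌋₊ → θ = α - k →
      -- the supremum defining the profile is a maximum
      IsGreatest
        (FractionalPositivity.quadForm (FractionalPositivity.omegaProj d) ''
          FractionalPositivity.admissible d d α)
        (FractionalPositivity.profile d α) ∧
      -- its value
      FractionalPositivity.profile d α = (k + θ) ^ 2 / (d * (k + θ ^ 2)) ∧
      -- a maximizer with the stated Schmidt coefficients
      (∃ ψ ∈ FractionalPositivity.admissible d d α,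
        FractionalPositivity.quadForm (FractionalPositivity.omegaProj d) ψ =
          FractionalPositivity.profile d α ∧
        (∀ j < k, FractionalPositivity.schmidtCoeff ψ j = 1 / Real.sqrt (k + θ ^ 2)) ∧
        FractionalPositivity.schmidtCoeff ψ k = θ / Real.sqrt (k + θ ^ 2) ∧
        (∀ j, k + 1 ≤ j → FractionalPositivity.schmidtCoeff ψ j = 0)) ∧
      -- membership of the isotropic states
      (∀ F : ℝ, 0 ≤ F → F ≤ 1 →
        (FractionalPositivity.isotropicState d F ∈
            FractionalPositivity.superpositiveCone d d α ↔
          F ≤ FractionalPositivity.profile d α))) ∧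
    -- the integer levels
    (∀ k : ℕ, 1 ≤ k → k ≤ d →
      FractionalPositivity.profile d k = k / d ∧
      ∀ F : ℝ, 0 ≤ F → F ≤ 1 →
        (FractionalPositivity.isotropicState d F ∈
            FractionalPositivity.superpositiveCone d d (k : ℝ) ↔
          F ≤ k / d)) := by
  refine ⟨fun α hα hαd k θ hk hθ => ?_, fun k hk hkd => ?_⟩
  · have hp := FractionalPositivity.profile_eq hα hαd hk hθ
    obtain ⟨ψ, hψ, hq, hs⟩ := FractionalPositivity.exists_mem_admissible_maximizer hα hαd hk hθ
    refine ⟨?_, hp, ⟨ψ, hψ, hq.trans hp.symm, hs⟩, fun F hF _ => ?_⟩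
    · rw [hp]
      exact FractionalPositivity.isGreatest_quadForm_omegaProj hα hαd hk hθ
    · exact FractionalPositivity.isotropicState_mem_superpositiveCone_iff hd hα hαd hF
  · have hp := FractionalPositivity.profile_natCast hk hkd
    refine ⟨hp, fun F hF _ => ?_⟩
    rw [← hp]
    exact FractionalPositivity.isotropicState_mem_superpositiveCone_iff hd (by exact_mod_cast hk)
      (by exact_mod_cast hkd) hF
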